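/- **Theorem 1.1.** Let $D\subset\mathbf C^n$ be a bounded domain (a nonempty bounded connected open set). A *$C^{1,1}$ defining function* for $D$ on an open set $U_0\supset\overline D$ is a real function $r$ that is continuously differentiable on $U_0$ with locally Lipschitz first derivatives, such that $D=\{z\in U_0: r(z)<0\}$ and $dr\neq0$ at every point of $\partial D$. Write $$r_\zeta\cdot(\zeta-z)=\sum_{j=1}^n\frac{\partial r}{\partial\zeta_j}(\zeta)\,(\zeta_j-z_j),\qquad \frac{\partial}{\partial \zeta_j}=\frac12\Big(\frac{\partial}{\partial x_j}-i\frac{\partial}{\partial y_j}\Big),\quad \zeta_j=x_j+iy_j .$$ Let $r$ be any $C^{1,1}$ defining function for $D$ on $U_0$. Then the condition of strong $\mathbf C$-linear convexity, (0) there is $c>0$ with $|r_\zeta\cdot(\zeta-z)|\ge c|\zeta-z|^2$ for all $z\in\overline D$, $\zeta\in\partial D$, is equivalent to each of the following three conditions on the same $r$: (a) there are an open set $U$ with $\overline D\subset U\subset U_0$ and $c_1>0$ such that $|r_\zeta\cdot(\zeta-z)|\ge c_1|\zeta-z|^2$ for all $z\in\overline D$, $\zeta\in U\setminus D$; (b)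 there are an open set $U$ with $\overline D\subset U\subset U_0$ and $c_2>0$ such that $|r_\zeta\cdot(\zeta-z)|\ge c_2\big(r(\zeta)-r(z)+|\zeta-z|^2\big)$ for all $z\in\overline D$, $\zeta\in U\setminus D$; (c) there is $c_3>0$ with $|r_\zeta\cdot(\zeta-z)|\ge c_3|\zeta-z|^2$ for all $\zeta,z\in\partial D$. The neighbourhoods $U$ in (a) and (b) need not be the same. Moreover, condition (a) does not depend on the choice of the $C^{1,1}$ defining function: if $r$ and $\tilde r$ are $C^{1,1}$ defining functions for $D$ on open neighbourhoods $U_0$ and $\tilde U_0$ of $\overline D$, then $r$ satisfies (a) if and only if $\tilde r$ satisfies (a) (with $\tilde U_0$ in place of $U_0$, and possibly a different $U$ and constant). -/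

import Mathlib

/-- The Wirtinger derivative `∂r/∂ζ_j = (1/2) (∂r/∂x_j - i ∂r/∂y_j)` of a real function `r` on `ℂⁿ`
at the point `ζ`, where `ζ_j = x_j + i y_j`. -/
noncomputable def wirtingerDeriv {n : ℕ} (r : EuclideanSpace ℂ (Fin n) → ℝ)
    (ζ : EuclideanSpace ℂ (Fin n)) (j : Fin n) : ℂ :=
  (1 / 2 : ℂ) * ((fderiv ℝ r ζ (EuclideanSpace.single j (1 : ℂ)) : ℂ)
    - Complex.I * (fderiv ℝ r ζ (EuclideanSpace.single j Complex.I) : ℂ))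

/-- The bilinear pairing `r_ζ · (ζ - z) = ∑ j, (∂r/∂ζ_j)(ζ) (ζ_j - z_j)`. -/
noncomputable def lerayPairing {n : ℕ} (r : EuclideanSpace ℂ (Fin n) → ℝ)
    (ζ z : EuclideanSpace ℂ (Fin n)) : ℂ :=
  ∑ j : Fin n, wirtingerDeriv r ζ j * (ζ j - z j)

/-- `r` is a defining function for `D`, of class `C^{1,1}` on the open neighbourhood `U` of the
closure of `D`. Values of `r` outside `U` are irrelevant. The Lipschitz condition on the first
derivatives is only asked locally on `U`. -/
structure IsC11DefiningFunction {n : ℕ} (D U : Set (EuclideanSpace ℂ (Fin n)))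
    (r : EuclideanSpace ℂ (Fin n) → ℝ) : Prop where
  isOpen : IsOpen U
  closure_subset : closure D ⊆ U
  contDiffOn : ContDiffOn ℝ 1 r U
  locallyLipschitzOn_fderiv : LocallyLipschitzOn U (fderiv ℝ r)
  eq_sublevel : D = {z | z ∈ U ∧ r z < 0}
  fderiv_ne_zero : ∀ ζ ∈ frontier D, fderiv ℝ r ζ ≠ 0

/-- Strong `ℂ`-linear convexity of `D`, expressed with the defining function `r`. -/
def StronglyCLinearlyConvex {n : ℕ} (D : Set (EuclideanSpace ℂ (Fin n)))
    (r : EuclideanSpace ℂ (Fin n) → ℝ) : Prop :=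
  ∃ c : ℝ, 0 < c ∧ ∀ z ∈ closure D, ∀ ζ ∈ frontier D,
    c * ‖ζ - z‖ ^ 2 ≤ ‖lerayPairing r ζ z‖

/-- The quadratic bound for `ζ ∈ U \ D`, for some neighbourhood `U` of the closure of `D` inside the
set `U₀` on which `r` is given. -/
def ExteriorQuadraticBound {n : ℕ} (D U₀ : Set (EuclideanSpace ℂ (Fin n)))
    (r : EuclideanSpace ℂ (Fin n) → ℝ) : Prop :=
  ∃ U : Set (EuclideanSpace ℂ (Fin n)), IsOpen U ∧ closure D ⊆ U ∧ U ⊆ U₀ ∧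
    ∃ c : ℝ, 0 < c ∧ ∀ z ∈ closure D, ∀ ζ ∈ U \ D,
      c * ‖ζ - z‖ ^ 2 ≤ ‖lerayPairing r ζ z‖

/-- The bound by `r(ζ) - r(z) + |ζ - z|²` for `ζ ∈ U \ D`, for some neighbourhood `U` of the closure
of `D` inside the set `U₀` on which `r` is given. -/
def ExteriorDefiningBound {n : ℕ} (D U₀ : Set (EuclideanSpace ℂ (Fin n)))
    (r : EuclideanSpace ℂ (Fin n) → ℝ) : Prop :=
  ∃ U : Set (EuclideanSpace ℂ (Fin n)), IsOpen U ∧ closure D ⊆ U ∧ U ⊆ U₀ ∧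
    ∃ c : ℝ, 0 < c ∧ ∀ z ∈ closure D, ∀ ζ ∈ U \ D,
      c * (r ζ - r z + ‖ζ - z‖ ^ 2) ≤ ‖lerayPairing r ζ z‖

/-- The quadratic bound for `ζ` and `z` both in the boundary of `D`. -/
def BoundaryQuadraticBound {n : ℕ} (D : Set (EuclideanSpace ℂ (Fin n)))
    (r : EuclideanSpace ℂ (Fin n) → ℝ) : Prop :=
  ∃ c : ℝ, 0 < c ∧ ∀ z ∈ frontier D, ∀ ζ ∈ frontier D,
    c * ‖ζ - z‖ ^ 2 ≤ ‖lerayPairing r ζ z‖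

/-!
Twice the pairing `r_ζ · (ζ - z)` is the `ℂ`-linear extension of the real functional `dr(ζ)`, applied
to `ζ - z`. In particular its real part is `dr(ζ)(ζ - z) / 2`, and Taylor's formula, whose remainder
is quadratic because `dr` is Lipschitz, compares it with `r ζ - r z`.

The implication with content is the passage from boundary points `ζ` to exterior ones
(`exists_eventually_bound_diagonal`). If `ζ ∉ D` and `z ∈ closure D` are close to `p ∈ frontier D`
and `dr(p)(w) = 1`, translate both points by `-t • w` until `ζ` reaches the boundary. The translate
`z'` of `z` stays in `closure D`, with `r z' ≤ r z - t / 2`, and `ζ - z` is unchanged, so the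
hypothesis and Taylor's formula bound the pairing of the translates below by a multiple of
`-r z + t / 2 + ‖ζ - z‖ ^ 2`. Only the coefficient `dr(ζ)` varies under the translation, which costs
`O(t ‖ζ - z‖)` and is absorbed by the term in `t`; finally `r ζ = O(t)`. Away from the diagonal the
bound is continuity, and compactness of `frontier D ×ˢ closure D` makes the constant uniform
(`IsCompact.exists_pos_eventually_nhdsSet`).

The bound for `z` in the boundary implies the one for `z ∈ D` with the same constant when `n ≥ 2`:
the affine hyperplane through `z` on which the pairing with `ζ` is constant contains a ray from `z`
that does not approach `ζ`, and this ray meets the boundary since `D` is bounded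
(`exists_mem_frontier_lerayPairing_eq`). When `n = 1` the pairing is a product and the bound always
holds.

The differentials of two defining functions are proportional on the boundary, because neither
function can increase in a direction in which the other decreases (`exists_fderiv_eq_smul`). By
compactness the factors are bounded away from zero, so strong `ℂ`-linear convexity does not depend
on the defining function, and neither does the equivalent exterior bound.
-/

open Set Filter Topology

/-! ### The pairing as a complex functional -/

theorem lerayPairing_eq_extendRCLike {n : ℕ} (r : EuclideanSpace ℂ (Fin n) → ℝ)
    (ζ z : EuclideanSpace ℂ (Fin n)) :
    lerayPairing r ζ z =
      (1 / 2 : ℂ) * StrongDual.extendRCLikeₗᵢ (𝕜 := ℂ) (fderiv ℝ r ζ) (ζ - z) := by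
  set Φ := StrongDual.extendRCLikeₗᵢ (𝕜 := ℂ) (fderiv ℝ r ζ) with hΦ
  have hv : ζ - z = ∑ j, (ζ j - z j) • EuclideanSpace.single j (1 : ℂ) := by
    ext i
    simp [Finset.sum_apply, Pi.single_apply]
  rw [hv, map_sum, Finset.mul_sum]
  refine Finset.sum_congr rfl fun j _ => ?_
  have h1 : Φ (EuclideanSpace.single j (1 : ℂ)) =
      (fderiv ℝ r ζ (EuclideanSpace.single j (1 : ℂ)) : ℂ)
      - Complex.I * (fderiv ℝ r ζ (EuclideanSpace.single j Complex.I) : ℂ) := by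
    have : Complex.I • EuclideanSpace.single j (1 : ℂ) = EuclideanSpace.single j Complex.I := by
      ext i
      simp
    rw [← this]
    rfl
  rw [map_smul, h1, wirtingerDeriv, smul_eq_mul]
  ring

theorem abs_fderiv_le_two_mul_norm_lerayPairing {n : ℕ} (r : EuclideanSpace ℂ (Fin n) → ℝ)
    (ζ z : EuclideanSpace ℂ (Fin n)) :
    |fderiv ℝ r ζ (ζ - z)| ≤ 2 * ‖lerayPairing r ζ z‖ := by
  have h : fderiv ℝ r ζ (ζ - z) = (2 * lerayPairing r ζ z).re := by
    rw [lerayPairing_eq_extendRCLike, ← mul_assoc]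
    rw [show (2 : ℂ) * (1 / 2) = 1 by norm_num, one_mul]
    exact (StrongDual.re_extendRCLike_apply (𝕜 := ℂ) (fderiv ℝ r ζ) (ζ - z)).symm
  rw [h]
  exact (Complex.abs_re_le_norm _).trans (by simp)

theorem norm_lerayPairing_sub_le {n : ℕ} (r : EuclideanSpace ℂ (Fin n) → ℝ)
    {ζ z ζ' z' : EuclideanSpace ℂ (Fin n)} (h : ζ' - z' = ζ - z) :
    ‖lerayPairing r ζ z - lerayPairing r ζ' z'‖ ≤
      ‖fderiv ℝ r ζ - fderiv ℝ r ζ'‖ * ‖ζ - z‖ := by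
  rw [lerayPairing_eq_extendRCLike, lerayPairing_eq_extendRCLike, h, ← mul_sub,
    ← sub_apply, ← map_sub, norm_mul]
  have h1 := (StrongDual.extendRCLikeₗᵢ (𝕜 := ℂ) (fderiv ℝ r ζ - fderiv ℝ r ζ')).le_opNorm (ζ - z)
  rw [LinearIsometryEquiv.norm_map] at h1
  refine le_trans ?_ h1
  have : ‖(1 / 2 : ℂ)‖ ≤ 1 := by norm_num
  exact mul_le_of_le_one_left (norm_nonneg _) this

/-! ### Topological preliminaries -/

theorem IsPreconnected.inter_frontier_nonempty_of_isOpen {X : Type*} [TopologicalSpace X]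
    {s D : Set X} (hs : IsPreconnected s) (hD : IsOpen D) (h1 : (s ∩ D).Nonempty)
    (h2 : ¬ s ⊆ D) : (s ∩ frontier D).Nonempty := by
  by_contra h
  refine h2 (hs.subset_of_closure_inter_subset hD h1 fun x hx => ?_)
  by_contra hxD
  exact h ⟨x, hx.2, hx.1, by rwa [hD.interior_eq]⟩

/-- On a compact set, local estimates with a constant that may be decreased hold with a common
constant on a neighbourhood of the whole set. -/
theorem IsCompact.exists_pos_eventually_nhdsSet {X : Type*} [TopologicalSpace X] {K : Set X}
    (hK : IsCompact K) {P : ℝ → X → Prop}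
    (mono : ∀ x c c', 0 < c' → c' ≤ c → P c x → P c' x)
    (h : ∀ x ∈ K, ∃ c > 0, ∀ᶠ y in 𝓝 x, P c y) :
    ∃ c > 0, ∀ᶠ y in 𝓝ˢ K, P c y := by
  refine hK.induction_on (p := fun s => ∃ c > 0, ∀ᶠ y in 𝓝ˢ s, P c y) ⟨1, one_pos, by simp⟩
    ?_ ?_ ?_
  · rintro s t hst ⟨c, hc, H⟩
    exact ⟨c, hc, H.filter_mono (nhdsSet_mono hst)⟩
  · rintro s t ⟨c, hc, H⟩ ⟨d, hd, H'⟩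
    refine ⟨min c d, lt_min hc hd, ?_⟩
    rw [nhdsSet_union, eventually_sup]
    exact ⟨H.mono fun y => mono _ _ _ (lt_min hc hd) (min_le_left _ _),
      H'.mono fun y => mono _ _ _ (lt_min hc hd) (min_le_right _ _)⟩
  · intro x hx
    obtain ⟨c, hc, H⟩ := h x hx
    obtain ⟨o, ho, hoo, hxo⟩ := eventually_nhds_iff.1 H
    refine ⟨o, mem_nhdsWithin_of_mem_nhds (hoo.mem_nhds hxo), c, hc, ?_⟩
    rw [hoo.nhdsSet_eq]
    exact ho

namespace IsC11DefiningFunction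

variable {n : ℕ} {D U : Set (EuclideanSpace ℂ (Fin n))} {r : EuclideanSpace ℂ (Fin n) → ℝ}

/-! ### Elementary properties of defining functions -/

theorem differentiableAt (hr : IsC11DefiningFunction D U r) {x : EuclideanSpace ℂ (Fin n)}
    (hx : x ∈ U) : DifferentiableAt ℝ r x :=
  (hr.contDiffOn.differentiableOn one_ne_zero).differentiableAt (hr.isOpen.mem_nhds hx)

theorem continuousOn_fderiv (hr : IsC11DefiningFunction D U r) : ContinuousOn (fderiv ℝ r) U :=
  hr.contDiffOn.continuousOn_fderiv_of_isOpen hr.isOpen le_rfl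

theorem mem_of_neg (hr : IsC11DefiningFunction D U r) {x : EuclideanSpace ℂ (Fin n)}
    (hx : x ∈ U) (h : r x < 0) : x ∈ D := by
  rw [hr.eq_sublevel]
  exact ⟨hx, h⟩

theorem nonneg_of_notMem (hr : IsC11DefiningFunction D U r) {x : EuclideanSpace ℂ (Fin n)}
    (hx : x ∈ U) (h : x ∉ D) : 0 ≤ r x := by
  by_contra! hneg
  exact h (hr.mem_of_neg hx hneg)

theorem nonpos_of_mem_closure (hr : IsC11DefiningFunction D U r) {x : EuclideanSpace ℂ (Fin n)}
    (hx : x ∈ closure D) : r x ≤ 0 := by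
  have hc : ContinuousWithinAt r D x :=
    (hr.differentiableAt (hr.closure_subset hx)).continuousAt.continuousWithinAt
  have hm := hc.mem_closure_image hx
  have hsub : r '' D ⊆ Iic 0 := by
    rintro _ ⟨y, hy, rfl⟩
    rw [hr.eq_sublevel] at hy
    exact hy.2.le
  simpa using closure_minimal hsub isClosed_Iic hm

theorem isOpen_domain (hr : IsC11DefiningFunction D U r) : IsOpen D := by
  have h : D = U ∩ r ⁻¹' Iio 0 := hr.eq_sublevel
  rw [h]
  exact hr.contDiffOn.continuousOn.isOpen_inter_preimage hr.isOpen isOpen_Iio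

theorem notMem_of_mem_frontier (hr : IsC11DefiningFunction D U r) {x : EuclideanSpace ℂ (Fin n)}
    (hx : x ∈ frontier D) : x ∉ D := by
  rw [hr.isOpen_domain.frontier_eq] at hx
  exact hx.2

theorem frontier_subset (hr : IsC11DefiningFunction D U r) : frontier D ⊆ U :=
  frontier_subset_closure.trans hr.closure_subset

theorem eq_zero_of_mem_frontier (hr : IsC11DefiningFunction D U r)
    {x : EuclideanSpace ℂ (Fin n)} (hx : x ∈ frontier D) : r x = 0 :=
  le_antisymm (hr.nonpos_of_mem_closure (frontier_subset_closure hx))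
    (hr.nonneg_of_notMem (hr.frontier_subset hx) (hr.notMem_of_mem_frontier hx))

/-! ### The exterior bound near a boundary point -/

/-- A first-order Taylor estimate: a Lipschitz derivative makes the remainder quadratic. -/
theorem abs_sub_sub_fderiv_le {K ρ : ℝ} {p x y : EuclideanSpace ℂ (Fin n)} (hK : 0 ≤ K)
    (hr : IsC11DefiningFunction D U r) (hU : Metric.ball p ρ ⊆ U)
    (hL : ∀ u ∈ Metric.ball p ρ, ∀ v ∈ Metric.ball p ρ,
      ‖fderiv ℝ r u - fderiv ℝ r v‖ ≤ K * ‖u - v‖)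
    (hx : x ∈ Metric.ball p ρ) (hy : y ∈ Metric.ball p ρ) :
    |r y - r x - fderiv ℝ r x (y - x)| ≤ K * ‖y - x‖ ^ 2 := by
  have hseg : segment ℝ x y ⊆ Metric.ball p ρ := (convex_ball p ρ).segment_subset hx hy
  have := (convex_segment x y).norm_image_sub_le_of_norm_fderiv_le' (𝕜 := ℝ) (f := r)
    (φ := fderiv ℝ r x) (C := K * ‖y - x‖) (fun u hu => hr.differentiableAt (hU (hseg hu)))
    (fun u hu => (hL u (hseg hu) x hx).trans
      (mul_le_mul_of_nonneg_left (norm_sub_le_of_mem_segment hu) hK))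
    (left_mem_segment ℝ x y) (right_mem_segment ℝ x y)
  rw [Real.norm_eq_abs] at this
  linarith

/-- Where the derivative in the direction `w` lies between `1/2` and `C`, so do the difference
quotients of `r` along `w`. -/
theorem bounds_of_fderiv_apply_mem_Icc {ρ C : ℝ} {p x w : EuclideanSpace ℂ (Fin n)}
    (hr : IsC11DefiningFunction D U r) (hU : Metric.ball p ρ ⊆ U)
    (hw : ∀ u ∈ Metric.ball p ρ, fderiv ℝ r u w ∈ Icc (1 / 2) C) {t : ℝ} (ht : 0 ≤ t)
    (hx : x ∈ Metric.ball p ρ) (hy : x - t • w ∈ Metric.ball p ρ) :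
    t / 2 ≤ r x - r (x - t • w) ∧ r x - r (x - t • w) ≤ C * t := by
  have hseg : segment ℝ x (x - t • w) ⊆ Metric.ball p ρ := (convex_ball p ρ).segment_subset hx hy
  obtain ⟨u, hu, he⟩ := domain_mvt (f := r) (s := segment ℝ x (x - t • w)) (f' := fderiv ℝ r)
    (fun u hu => (hr.differentiableAt (hU (hseg hu))).hasFDerivAt.hasFDerivWithinAt)
    (convex_segment _ _) (left_mem_segment ℝ _ _) (right_mem_segment ℝ _ _)
  have hu' := hw u (hseg ((convex_segment _ _).segment_subset (left_mem_segment ℝ _ _)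
    (right_mem_segment ℝ _ _) hu))
  have h1 : r x - r (x - t • w) = t * fderiv ℝ r u w := by
    have : x - t • w - x = (-t) • w := by module
    rw [this, map_smul, smul_eq_mul] at he
    linarith
  rw [h1]
  constructor
  · nlinarith [hu'.1]
  · nlinarith [hu'.2]

/-- The strong condition at boundary points gives `ExteriorDefiningBound` near the diagonal.
Given `ζ` outside `D` and `z` in its closure, both points are moved by the same vector `-t • w` so
that `ζ` lands on the boundary. The difference `ζ - z` does not change, `r` decreases by at least
`t / 2` at `z`, and the change of the pairing, of size `t * ‖ζ - z‖`, is absorbed by this gain. -/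
theorem exists_eventually_bound_diagonal (hr : IsC11DefiningFunction D U r)
    (h0 : StronglyCLinearlyConvex D r) {p : EuclideanSpace ℂ (Fin n)} (hp : p ∈ frontier D) :
    ∃ c > 0, ∀ᶠ q : EuclideanSpace ℂ (Fin n) × EuclideanSpace ℂ (Fin n) in 𝓝 (p, p),
      q.1 ∈ U \ D → q.2 ∈ closure D →
        c * (r q.1 - r q.2 + ‖q.1 - q.2‖ ^ 2) ≤ ‖lerayPairing r q.1 q.2‖ := by
  obtain ⟨c, hc, h0⟩ := h0
  have hpU : p ∈ U := hr.frontier_subset hp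
  obtain ⟨w, hw⟩ : ∃ w, fderiv ℝ r p w = 1 := by
    obtain ⟨v, hv⟩ := DFunLike.ne_iff.1 (hr.fderiv_ne_zero p hp)
    refine ⟨(fderiv ℝ r p v)⁻¹ • v, ?_⟩
    rw [map_smul, smul_eq_mul]
    exact inv_mul_cancel₀ hv
  have hw0 : 0 < ‖w‖ := by
    rw [norm_pos_iff]
    rintro rfl
    simp at hw
  obtain ⟨K₀, T, hT, hLip⟩ := hr.locallyLipschitzOn_fderiv hpU
  rw [hr.isOpen.nhdsWithin_eq hpU] at hT
  have hcw : ContinuousAt (fun u => fderiv ℝ r u w) p :=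
    ((hr.continuousOn_fderiv.continuousAt (hr.isOpen.mem_nhds hpU)).clm_apply continuousAt_const)
  have hev : ∀ᶠ u in 𝓝 p, u ∈ U ∧ u ∈ T ∧ fderiv ℝ r u w ∈ Icc (1 / 2 : ℝ) 2 :=
    Filter.Eventually.and (hr.isOpen.mem_nhds hpU) (Filter.Eventually.and hT (hcw (Icc_mem_nhds
      (by simp only [hw]; norm_num) (by simp only [hw]; norm_num))))
  obtain ⟨ρ, hρ, hball⟩ := Metric.eventually_nhds_iff_ball.1 hev
  have hU : Metric.ball p ρ ⊆ U := fun u hu => (hball u hu).1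
  have hwI : ∀ u ∈ Metric.ball p ρ, fderiv ℝ r u w ∈ Icc (1 / 2 : ℝ) 2 :=
    fun u hu => (hball u hu).2.2
  set K : ℝ := (K₀ : ℝ)
  have hK : 0 ≤ K := K₀.2
  have hL : ∀ u ∈ Metric.ball p ρ, ∀ v ∈ Metric.ball p ρ,
      ‖fderiv ℝ r u - fderiv ℝ r v‖ ≤ K * ‖u - v‖ := fun u hu v hv =>
    hLip.norm_sub_le (hball u hu).2.1 (hball v hv).2.1
  set M : ℝ := 2 + (K + 1) / c with hM
  have hMpos : 0 < M := by positivity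
  -- For `t ≤ τ` the points of the half-size ball stay in the ball when displaced by `t • w`.
  set τ : ℝ := ρ / (2 * ‖w‖) with hτ
  have hτpos : 0 < τ := by positivity
  have hτw : τ * ‖w‖ = ρ / 2 := by rw [hτ]; field_simp
  -- Points within `δ` of `p` have `‖ζ - z‖ ≤ 2 * δ`, small enough to absorb the error term.
  set δ : ℝ := 1 / (8 * M * (K * ‖w‖ + 1)) with hδ
  have hδpos : 0 < δ := by positivity
  have hδM : M * (K * ‖w‖ * (2 * δ)) ≤ 1 / 4 := by
    have : M * (K * ‖w‖ * (2 * δ)) = (K * ‖w‖) / (K * ‖w‖ + 1) * (1 / 4) := by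
      rw [hδ]; field_simp; ring
    rw [this]
    have h2 : (K * ‖w‖) / (K * ‖w‖ + 1) ≤ 1 := by
      rw [div_le_one (by positivity)]; linarith
    linarith
  have hrp : ∀ᶠ u in 𝓝 p, r u < τ / 2 := by
    refine (hr.differentiableAt hpU).continuousAt.eventually_lt continuousAt_const ?_
    rw [hr.eq_zero_of_mem_frontier hp]
    positivity
  have hnear : ∀ᶠ u in 𝓝 p, u ∈ Metric.ball p (min (ρ / 2) δ) :=
    Metric.ball_mem_nhds p (lt_min (by positivity) hδpos)
  -- The final estimate has `t / 4` on the left, and `r ζ ≤ 2 * t`, hence the factor `8`.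
  refine ⟨1 / (8 * M), by positivity, ?_⟩
  rw [nhds_prod_eq]
  filter_upwards [(hrp.and hnear).prod_mk hnear]
  rintro ⟨ζ, z⟩ ⟨⟨hζr, hζ⟩, hz⟩ ⟨hζU, hζD⟩ hzD
  simp only at hζr hζ hz hζU hζD hzD ⊢
  have hmove : ∀ x ∈ Metric.ball p (min (ρ / 2) δ), ∀ t ∈ Icc 0 τ,
      x - t • w ∈ Metric.ball p ρ := by
    intro x hx t ht
    have h1 : ‖x - p‖ < ρ / 2 := by
      rw [← dist_eq_norm]
      exact (Metric.mem_ball.1 hx).trans_le (min_le_left _ _)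
    have h2 : ‖t • w‖ ≤ ρ / 2 := by
      rw [norm_smul, Real.norm_of_nonneg ht.1, ← hτw]
      exact mul_le_mul_of_nonneg_right ht.2 hw0.le
    rw [Metric.mem_ball, dist_eq_norm]
    calc ‖x - t • w - p‖ = ‖(x - p) - t • w‖ := by congr 1; abel
      _ ≤ ‖x - p‖ + ‖t • w‖ := norm_sub_le _ _
      _ < ρ := by linarith
  have hζρ : ζ ∈ Metric.ball p ρ := by simpa using hmove ζ hζ 0 ⟨le_rfl, hτpos.le⟩
  have hzρ : z ∈ Metric.ball p ρ := by simpa using hmove z hz 0 ⟨le_rfl, hτpos.le⟩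
  -- The segment from `ζ` to `ζ - τ • w` starts outside `D` and ends in `D`.
  obtain ⟨t, ht, htF⟩ : ∃ t ∈ Icc 0 τ, ζ - t • w ∈ frontier D := by
    have hpre : IsPreconnected ((fun t : ℝ => ζ - t • w) '' Icc 0 τ) :=
      isPreconnected_Icc.image _ (by fun_prop)
    obtain ⟨_, ⟨t, ht, rfl⟩, hF⟩ := hpre.inter_frontier_nonempty_of_isOpen hr.isOpen_domain
      ⟨_, ⟨τ, ⟨hτpos.le, le_rfl⟩, rfl⟩, by
        have h1 := hmove ζ hζ τ ⟨hτpos.le, le_rfl⟩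
        refine hr.mem_of_neg (hU h1) ?_
        have := (hr.bounds_of_fderiv_apply_mem_Icc hU hwI hτpos.le hζρ h1).1
        simp only
        linarith⟩
      (fun hsub => hζD (hsub ⟨0, ⟨le_rfl, hτpos.le⟩, by simp⟩))
    exact ⟨t, ht, hF⟩
  set ζ' := ζ - t • w with hζ'
  set z' := z - t • w with hz'
  have hdiff : ζ' - z' = ζ - z := by rw [hζ', hz']; abel
  have hζ'ρ := hmove ζ hζ t ht
  have hz'ρ := hmove z hz t ht
  have hrζ' : r ζ' = 0 := hr.eq_zero_of_mem_frontier htF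
  have hrζ := (hr.bounds_of_fderiv_apply_mem_Icc hU hwI ht.1 hζρ hζ'ρ).2
  have hrz := (hr.bounds_of_fderiv_apply_mem_Icc hU hwI ht.1 hzρ hz'ρ).1
  have hrz0 := hr.nonpos_of_mem_closure hzD
  have hz'D : z' ∈ closure D := by
    rcases ht.1.eq_or_lt with h | h
    · rw [hz', ← h]
      simpa using hzD
    · exact subset_closure (hr.mem_of_neg (hU hz'ρ) (by linarith))
  set d := ‖ζ - z‖ with hd
  set A := ‖lerayPairing r ζ' z'‖ with hA
  have hA1 : c * d ^ 2 ≤ A := by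
    have := h0 z' hz'D ζ' htF
    rwa [hdiff] at this
  have hA2 : -r z' - K * d ^ 2 ≤ 2 * A := by
    have h1 := abs_fderiv_le_two_mul_norm_lerayPairing r ζ' z'
    have h2 := hr.abs_sub_sub_fderiv_le hK hU hL hζ'ρ hz'ρ
    have h3 : z' - ζ' = -(ζ' - z') := by abel
    rw [h3, map_neg, norm_neg, hdiff, hrζ'] at h2
    rw [hdiff] at h1
    have := (abs_le.1 h1).2
    have := (abs_le.1 h2).1
    linarith
  have hMA : -r z + t / 2 + d ^ 2 ≤ M * A := by
    have h1 : (K + 1) * d ^ 2 ≤ (K + 1) / c * A := by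
      rw [div_mul_eq_mul_div, le_div_iff₀ hc]
      nlinarith
    rw [hM]
    nlinarith
  have hdδ : d ≤ 2 * δ := by
    have h1 := (Metric.mem_ball.1 hζ).trans_le (min_le_right _ _)
    have h2 := (Metric.mem_ball.1 hz).trans_le (min_le_right _ _)
    have h3 := dist_triangle_right ζ z p
    rw [dist_eq_norm ζ z] at h3
    linarith
  have hB : A - ‖lerayPairing r ζ z‖ ≤ K * ‖w‖ * d * t := by
    have h1 := norm_lerayPairing_sub_le r hdiff
    have h2 := hL ζ hζρ ζ' hζ'ρ
    have h3 : ‖ζ - ζ'‖ = t * ‖w‖ := by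
      rw [hζ', sub_sub_cancel, norm_smul, Real.norm_of_nonneg ht.1]
    rw [h3] at h2
    have h4 := norm_sub_norm_le (lerayPairing r ζ' z') (lerayPairing r ζ z)
    rw [norm_sub_rev] at h4
    have h5 := mul_le_mul_of_nonneg_right h2 (norm_nonneg (ζ - z))
    calc _ ≤ _ := h4.trans (h1.trans h5)
      _ = _ := by rw [← hd]; ring
  have hB' : M * (K * ‖w‖ * d * t) ≤ t / 4 := by
    have h1 : M * (K * ‖w‖ * d) ≤ M * (K * ‖w‖ * (2 * δ)) := by gcongr
    have h2 := mul_le_mul_of_nonneg_right (h1.trans hδM) ht.1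
    linarith
  have hfin : -r z + t / 4 + d ^ 2 ≤ M * ‖lerayPairing r ζ z‖ := by
    have := mul_le_mul_of_nonneg_left hB hMpos.le
    linarith
  rw [div_mul_eq_mul_div, div_le_iff₀ (by positivity)]
  nlinarith [sq_nonneg d]

/-! ### The equivalences -/

theorem exteriorDefiningBound_of_stronglyCLinearlyConvex (hr : IsC11DefiningFunction D U r)
    (hb : Bornology.IsBounded D) (h0 : StronglyCLinearlyConvex D r) :
    ExteriorDefiningBound D U r := by
  have hcl : IsCompact (closure D) := hb.isCompact_closure
  have hfr : IsCompact (frontier D) := hcl.of_isClosed_subset isClosed_frontier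
    frontier_subset_closure
  obtain ⟨c, hc, H⟩ := (hfr.prod hcl).exists_pos_eventually_nhdsSet
    (P := fun c q => q.1 ∈ U \ D → q.2 ∈ closure D →
      c * (r q.1 - r q.2 + ‖q.1 - q.2‖ ^ 2) ≤ ‖lerayPairing r q.1 q.2‖)
    (by
      intro q c c' _ hcc h hq1 hq2
      refine (mul_le_mul_of_nonneg_right hcc ?_).trans (h hq1 hq2)
      have := hr.nonneg_of_notMem hq1.1 hq1.2
      have := hr.nonpos_of_mem_closure hq2
      positivity [show 0 ≤ r q.1 - r q.2 by linarith])
    (by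
      rintro ⟨ζ, z⟩ ⟨hζ, hz⟩
      simp only at hζ hz
      by_cases hne : ζ = z
      · subst hne
        exact hr.exists_eventually_bound_diagonal h0 hζ
      -- Off the diagonal the pairing does not vanish, and continuity suffices.
      · obtain ⟨c, hc, h0⟩ := h0
        have hpos : 0 < ‖lerayPairing r ζ z‖ := by
          refine lt_of_lt_of_le ?_ (h0 z hz ζ hζ)
          have : 0 < ‖ζ - z‖ := norm_pos_iff.2 (sub_ne_zero.2 hne)
          positivity
        have hζU := hr.frontier_subset hζ
        have hzU := hr.closure_subset hz
        have hcr1 : ContinuousAt (fun q : EuclideanSpace ℂ (Fin n) × EuclideanSpace ℂ (Fin n) =>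
            r q.1) (ζ, z) :=
          ContinuousAt.comp (f := Prod.fst) (g := r)
            (hr.differentiableAt hζU).continuousAt continuousAt_fst
        have hcr2 : ContinuousAt (fun q : EuclideanSpace ℂ (Fin n) × EuclideanSpace ℂ (Fin n) =>
            r q.2) (ζ, z) :=
          ContinuousAt.comp (f := Prod.snd) (g := r)
            (hr.differentiableAt hzU).continuousAt continuousAt_snd
        have hcf : ContinuousAt (fun q : EuclideanSpace ℂ (Fin n) × EuclideanSpace ℂ (Fin n) =>
            fderiv ℝ r q.1) (ζ, z) :=
          ContinuousAt.comp (f := Prod.fst) (g := fderiv ℝ r)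
            (hr.continuousOn_fderiv.continuousAt (hr.isOpen.mem_nhds hζU)) continuousAt_fst
        have hcL : ContinuousAt (fun q : EuclideanSpace ℂ (Fin n) × EuclideanSpace ℂ (Fin n) =>
            ‖lerayPairing r q.1 q.2‖) (ζ, z) := by
          simp only [lerayPairing_eq_extendRCLike]
          refine (continuousAt_const.mul (ContinuousAt.clm_apply ?_ (by fun_prop))).norm
          exact (StrongDual.extendRCLikeₗᵢ (𝕜 := ℂ)).continuous.continuousAt.comp hcf
        set B := r ζ - r z + ‖ζ - z‖ ^ 2 with hB
        refine ⟨‖lerayPairing r ζ z‖ / (2 * (|B| + 1)), by positivity, ?_⟩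
        have hlt : ∀ᶠ q : EuclideanSpace ℂ (Fin n) × EuclideanSpace ℂ (Fin n) in 𝓝 (ζ, z),
            ‖lerayPairing r ζ z‖ / (2 * (|B| + 1)) * (r q.1 - r q.2 + ‖q.1 - q.2‖ ^ 2)
              < ‖lerayPairing r q.1 q.2‖ := by
          refine (continuousAt_const.mul ((hcr1.sub hcr2).add (by fun_prop))).eventually_lt hcL ?_
          change ‖lerayPairing r ζ z‖ / (2 * (|B| + 1)) * (r ζ - r z + ‖ζ - z‖ ^ 2) <
            ‖lerayPairing r ζ z‖
          rw [← hB, div_mul_eq_mul_div, div_lt_iff₀ (by positivity)]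
          nlinarith [le_abs_self B, abs_nonneg B]
        exact hlt.mono fun q hq _ _ => hq.le)
  rw [hfr.nhdsSet_prod_eq hcl, eventually_prod_iff] at H
  obtain ⟨pa, hpa, pb, hpb, H⟩ := H
  obtain ⟨V, hV, hVf, hVp⟩ := eventually_nhdsSet_iff_exists.1 hpa
  refine ⟨(D ∪ V) ∩ U, (hr.isOpen_domain.union hV).inter hr.isOpen, ?_, inter_subset_right,
    c, hc, ?_⟩
  · refine subset_inter ?_ hr.closure_subset
    intro x hx
    by_cases hxD : x ∈ D
    · exact Or.inl hxD
    · exact Or.inr (hVf ⟨hx, by rwa [hr.isOpen_domain.interior_eq]⟩)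
  · rintro z hz ζ ⟨⟨hζ, hζU⟩, hζD⟩
    exact H (hVp ζ (hζ.resolve_left hζD)) (hpb.self_of_nhdsSet z hz) ⟨hζU, hζD⟩ hz

theorem exteriorQuadraticBound_of_exteriorDefiningBound (hr : IsC11DefiningFunction D U r)
    (h : ExteriorDefiningBound D U r) : ExteriorQuadraticBound D U r := by
  obtain ⟨V, hV, hDV, hVU, c, hc, h⟩ := h
  refine ⟨V, hV, hDV, hVU, c, hc, fun z hz ζ hζ => le_trans ?_ (h z hz ζ hζ)⟩
  have := hr.nonneg_of_notMem (hVU hζ.1) hζ.2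
  have := hr.nonpos_of_mem_closure hz
  exact mul_le_mul_of_nonneg_left (by linarith) hc.le

theorem stronglyCLinearlyConvex_of_exteriorQuadraticBound (hr : IsC11DefiningFunction D U r)
    (h : ExteriorQuadraticBound D U r) : StronglyCLinearlyConvex D r := by
  obtain ⟨V, hV, hDV, hVU, c, hc, h⟩ := h
  exact ⟨c, hc, fun z hz ζ hζ =>
    h z hz ζ ⟨hDV (frontier_subset_closure hζ), hr.notMem_of_mem_frontier hζ⟩⟩

theorem stronglyCLinearlyConvex_iff_exteriorQuadraticBound (hr : IsC11DefiningFunction D U r)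
    (hb : Bornology.IsBounded D) :
    StronglyCLinearlyConvex D r ↔ ExteriorQuadraticBound D U r :=
  ⟨fun h => hr.exteriorQuadraticBound_of_exteriorDefiningBound
    (hr.exteriorDefiningBound_of_stronglyCLinearlyConvex hb h),
    hr.stronglyCLinearlyConvex_of_exteriorQuadraticBound⟩

/-- The derivative of a defining function is bounded below on the boundary. -/
theorem exists_pos_le_norm_fderiv (hr : IsC11DefiningFunction D U r)
    (hb : Bornology.IsBounded D) :
    ∃ m > 0, ∀ ζ ∈ frontier D, m ≤ ‖fderiv ℝ r ζ‖ := by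
  have hfr : IsCompact (frontier D) := hb.isCompact_closure.of_isClosed_subset isClosed_frontier
    frontier_subset_closure
  exact hfr.exists_forall_le' (hr.continuousOn_fderiv.mono hr.frontier_subset).norm
    (fun ζ hζ => norm_pos_iff.2 (hr.fderiv_ne_zero ζ hζ))

/-- In dimension one every bounded domain with a `C^{1,1}` defining function is strongly
`ℂ`-linearly convex, because the pairing is a product. -/
theorem stronglyCLinearlyConvex_of_fin_one {D U : Set (EuclideanSpace ℂ (Fin 1))}
    {r : EuclideanSpace ℂ (Fin 1) → ℝ} (hr : IsC11DefiningFunction D U r)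
    (hb : Bornology.IsBounded D) : StronglyCLinearlyConvex D r := by
  obtain ⟨m, hm, hmle⟩ := hr.exists_pos_le_norm_fderiv hb
  obtain ⟨R, hRle⟩ := hb.closure.exists_norm_le
  refine ⟨m / (4 * (|R| + 1)), by positivity, fun z hz ζ hζ => ?_⟩
  set Φ := StrongDual.extendRCLikeₗᵢ (𝕜 := ℂ) (fderiv ℝ r ζ) with hΦ
  have hΦn : m ≤ ‖Φ‖ := by
    rw [hΦ, LinearIsometryEquiv.norm_map]
    exact hmle ζ hζ
  have he : ∀ v : EuclideanSpace ℂ (Fin 1), ‖Φ v‖ = ‖Φ (EuclideanSpace.single 0 1)‖ * ‖v‖ := by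
    intro v
    have h1 : v = v 0 • EuclideanSpace.single 0 (1 : ℂ) := by
      ext i
      fin_cases i
      simp
    have h2 : ‖v‖ = ‖v 0‖ := by
      conv_lhs => rw [h1]
      simp [norm_smul]
    conv_lhs => rw [h1]
    rw [map_smul, norm_smul, h2, mul_comm]
  have hΦ1 : m ≤ ‖Φ (EuclideanSpace.single 0 1)‖ :=
    hΦn.trans (Φ.opNorm_le_bound (norm_nonneg _) fun v => (he v).le)
  have hd : ‖ζ - z‖ ≤ 2 * (|R| + 1) := by
    have h1 := hRle ζ (frontier_subset_closure hζ)
    have h2 := hRle z hz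
    have h3 := norm_sub_le ζ z
    have h4 := le_abs_self R
    linarith
  have hL : ‖lerayPairing r ζ z‖ = 1 / 2 * (‖Φ (EuclideanSpace.single 0 1)‖ * ‖ζ - z‖) := by
    rw [lerayPairing_eq_extendRCLike, norm_mul, ← hΦ, he]
    norm_num
  rw [hL, div_mul_eq_mul_div, div_le_iff₀ (by positivity)]
  have h1 : m * (‖ζ - z‖ * ‖ζ - z‖) ≤
      ‖Φ (EuclideanSpace.single 0 1)‖ * (‖ζ - z‖ * (2 * (|R| + 1))) := by gcongr
  linarith

/-- In dimension at least two, a ray from a point `z` of `D`, in a direction annihilated by the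
pairing at `ζ` and not pointing towards `ζ`, leaves the bounded set `D` at a point that has the
same pairing with `ζ` as `z` and is not closer to `ζ`. -/
theorem exists_mem_frontier_lerayPairing_eq (hD : IsOpen D) (hb : Bornology.IsBounded D)
    (hn : 2 ≤ n) (r : EuclideanSpace ℂ (Fin n) → ℝ) (ζ : EuclideanSpace ℂ (Fin n))
    {z : EuclideanSpace ℂ (Fin n)} (hz : z ∈ D) :
    ∃ x ∈ frontier D, lerayPairing r ζ x = lerayPairing r ζ z ∧ ‖ζ - z‖ ≤ ‖ζ - x‖ := by
  set Φ := StrongDual.extendRCLikeₗᵢ (𝕜 := ℂ) (fderiv ℝ r ζ) with hΦ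
  obtain ⟨v, hv0, hvΦ, hv⟩ : ∃ v, v ≠ 0 ∧ Φ v = 0 ∧ inner ℝ (ζ - z) v ≤ 0 := by
    have hker : LinearMap.ker (Φ : EuclideanSpace ℂ (Fin n) →ₗ[ℂ] ℂ) ≠ ⊥ :=
      LinearMap.ker_ne_bot_of_finrank_lt (by simp; omega)
    obtain ⟨v, hv, hv0⟩ := Submodule.exists_mem_ne_zero_of_ne_bot hker
    have hv' : Φ v = 0 := hv
    rcases le_total (inner ℝ (ζ - z) v) 0 with h | h
    · exact ⟨v, hv0, hv', h⟩
    · exact ⟨-v, neg_ne_zero.2 hv0, by rw [map_neg, hv', neg_zero], by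
        rw [inner_neg_right]; linarith⟩
  have hpre : IsPreconnected ((fun s : ℝ => z + s • v) '' Ici 0) :=
    isPreconnected_Ici.image _ (by fun_prop)
  obtain ⟨_, ⟨s, hs, rfl⟩, hF⟩ := hpre.inter_frontier_nonempty_of_isOpen hD
    ⟨z, ⟨0, by simp, by simp⟩, hz⟩ (by
      intro hsub
      obtain ⟨R, hR⟩ := hb.exists_norm_le
      have hvn : 0 < ‖v‖ := norm_pos_iff.2 hv0
      have hR0 : ‖z‖ ≤ R := hR z hz
      have hs0 : 0 ≤ (2 * R + 1) / ‖v‖ := by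
        have := norm_nonneg z
        positivity [show 0 ≤ R by linarith]
      have h1 := hR _ (hsub ⟨(2 * R + 1) / ‖v‖, hs0, rfl⟩)
      have h2 : ‖((2 * R + 1) / ‖v‖) • v‖ = 2 * R + 1 := by
        rw [norm_smul, Real.norm_of_nonneg hs0]
        field_simp
      have h3 := norm_sub_le (z + ((2 * R + 1) / ‖v‖) • v) z
      rw [add_sub_cancel_left, h2] at h3
      simp only at h1
      linarith)
  refine ⟨_, hF, ?_, ?_⟩
  · have h1 : Φ (s • v) = 0 := by
      rw [← Complex.coe_smul, map_smul, hvΦ, smul_zero]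
    rw [lerayPairing_eq_extendRCLike, lerayPairing_eq_extendRCLike, ← sub_sub, map_sub, ← hΦ, h1,
      sub_zero]
  · rw [← sub_sub]
    refine le_of_sq_le_sq ?_ (norm_nonneg _)
    rw [norm_sub_sq_real (ζ - z) (s • v), inner_smul_right]
    have h1 : s * inner ℝ (ζ - z) v ≤ 0 := mul_nonpos_of_nonneg_of_nonpos hs hv
    have h2 := sq_nonneg ‖s • v‖
    linarith

theorem stronglyCLinearlyConvex_iff_boundaryQuadraticBound (hr : IsC11DefiningFunction D U r)
    (hb : Bornology.IsBounded D) :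
    StronglyCLinearlyConvex D r ↔ BoundaryQuadraticBound D r := by
  refine ⟨fun ⟨c, hc, h⟩ => ⟨c, hc, fun z hz => h z (frontier_subset_closure hz)⟩, ?_⟩
  rintro ⟨c, hc, h⟩
  obtain rfl | rfl | hn : n = 0 ∨ n = 1 ∨ 2 ≤ n := by omega
  · exact ⟨1, one_pos, fun z _ ζ _ => by simp [Subsingleton.elim ζ z]⟩
  · exact hr.stronglyCLinearlyConvex_of_fin_one hb
  · refine ⟨c, hc, fun z hz ζ hζ => ?_⟩
    by_cases hzD : z ∈ D
    · obtain ⟨x, hx, hL, hle⟩ :=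
        exists_mem_frontier_lerayPairing_eq hr.isOpen_domain hb hn r ζ hzD
      rw [← hL]
      refine le_trans ?_ (h x hx ζ hζ)
      gcongr
    · exact h z ⟨hz, by rwa [hr.isOpen_domain.interior_eq]⟩ ζ hζ

/-! ### Independence of the defining function -/

/-- Directions in which one defining function decreases point into `D`, so no other defining
function increases along them. -/
theorem fderiv_apply_nonpos_of_neg {U₁ : Set (EuclideanSpace ℂ (Fin n))}
    {r₁ : EuclideanSpace ℂ (Fin n) → ℝ} (hr : IsC11DefiningFunction D U r)
    (hr₁ : IsC11DefiningFunction D U₁ r₁) {ζ v : EuclideanSpace ℂ (Fin n)} (hζ : ζ ∈ frontier D)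
    (hv : fderiv ℝ r ζ v < 0) : fderiv ℝ r₁ ζ v ≤ 0 := by
  have hline : HasDerivAt (fun t : ℝ => ζ + t • v) v 0 := by
    simpa using ((hasDerivAt_id (0 : ℝ)).smul_const v).const_add ζ
  have hder : ∀ {V : Set (EuclideanSpace ℂ (Fin n))} {f : EuclideanSpace ℂ (Fin n) → ℝ},
      IsC11DefiningFunction D V f →
      HasDerivAt (fun t : ℝ => f (ζ + t • v)) (fderiv ℝ f ζ v) 0 := by
    intro V f hf
    refine HasFDerivAt.comp_hasDerivAt (f := fun t : ℝ => ζ + t • v) (0 : ℝ) ?_ hline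
    simpa using (hf.differentiableAt (hf.frontier_subset hζ)).hasFDerivAt
  have hin : ∀ᶠ t : ℝ in 𝓝[>] 0, ζ + t • v ∈ U := by
    refine nhdsWithin_le_nhds (hline.continuousAt (hr.isOpen.mem_nhds ?_))
    simpa using hr.frontier_subset hζ
  have hneg : ∀ᶠ t : ℝ in 𝓝[>] 0, r (ζ + t • v) < 0 := by
    have h1 : ∀ᶠ t : ℝ in 𝓝[>] 0, slope (fun t : ℝ => r (ζ + t • v)) 0 t < 0 :=
      ((hasDerivAt_iff_tendsto_slope.1 (hder hr)).mono_left
        (nhdsWithin_mono _ fun t (ht : 0 < t) => ht.ne')).eventually_lt_const hv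
    filter_upwards [h1, self_mem_nhdsWithin] with t ht ht0
    rw [slope_def_field, sub_zero, div_neg_iff] at ht
    have ht0' : (0 : ℝ) < t := ht0
    simp only [zero_smul, add_zero, hr.eq_zero_of_mem_frontier hζ, sub_zero] at ht
    rcases ht with h | h
    · linarith [h.2]
    · exact h.1
  have hlim : Tendsto (slope (fun t : ℝ => r₁ (ζ + t • v)) 0) (𝓝[>] 0)
      (𝓝 (fderiv ℝ r₁ ζ v)) :=
    (hasDerivAt_iff_tendsto_slope.1 (hder hr₁)).mono_left
      (nhdsWithin_mono _ fun t (ht : 0 < t) => ht.ne')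
  refine le_of_tendsto hlim ?_
  filter_upwards [hin, hneg, self_mem_nhdsWithin] with t htU ht ht0
  have hD := hr₁.nonpos_of_mem_closure (subset_closure (hr.mem_of_neg htU ht))
  rw [slope_def_field, sub_zero]
  refine div_nonpos_of_nonpos_of_nonneg ?_ (le_of_lt ht0)
  simpa [hr₁.eq_zero_of_mem_frontier hζ] using hD

theorem exists_fderiv_eq_smul {U₁ : Set (EuclideanSpace ℂ (Fin n))}
    {r₁ : EuclideanSpace ℂ (Fin n) → ℝ} (hr : IsC11DefiningFunction D U r)
    (hr₁ : IsC11DefiningFunction D U₁ r₁) {ζ : EuclideanSpace ℂ (Fin n)} (hζ : ζ ∈ frontier D) :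
    ∃ a : ℝ, fderiv ℝ r₁ ζ = a • fderiv ℝ r ζ := by
  obtain ⟨u, hu⟩ : ∃ u, fderiv ℝ r ζ u = -1 := by
    obtain ⟨v, hv⟩ := DFunLike.ne_iff.1 (hr.fderiv_ne_zero ζ hζ)
    refine ⟨(-(fderiv ℝ r ζ v)⁻¹) • v, ?_⟩
    rw [map_smul, smul_eq_mul, neg_mul]
    exact congrArg _ (inv_mul_cancel₀ hv)
  -- The kernel of `fderiv ℝ r ζ` is the limit of directions in which `r` decreases.
  have hker : ∀ v, fderiv ℝ r ζ v = 0 → fderiv ℝ r₁ ζ v ≤ 0 := by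
    intro v hv
    have hcont : Tendsto (fun ε : ℝ => fderiv ℝ r₁ ζ (v + ε • u)) (𝓝[>] 0)
        (𝓝 (fderiv ℝ r₁ ζ v)) := by
      have : Continuous (fun ε : ℝ => fderiv ℝ r₁ ζ (v + ε • u)) := by fun_prop
      simpa using (this.tendsto 0).mono_left nhdsWithin_le_nhds
    refine le_of_tendsto hcont ?_
    filter_upwards [self_mem_nhdsWithin] with ε hε
    refine hr.fderiv_apply_nonpos_of_neg hr₁ hζ ?_
    rw [map_add, map_smul, hv, hu]
    simpa using hε
  refine ⟨-fderiv ℝ r₁ ζ u, ContinuousLinearMap.ext fun v => ?_⟩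
  have h0 : fderiv ℝ r ζ (v + fderiv ℝ r ζ v • u) = 0 := by
    rw [map_add, map_smul, hu, smul_eq_mul]
    ring
  have h1 := hker _ h0
  have h2 := hker (-(v + fderiv ℝ r ζ v • u)) (by rw [map_neg, h0, neg_zero])
  rw [map_neg] at h2
  rw [map_add, map_smul, smul_eq_mul] at h1 h2
  rw [smul_apply, smul_eq_mul]
  linarith

theorem stronglyCLinearlyConvex_of_stronglyCLinearlyConvex
    {U₁ : Set (EuclideanSpace ℂ (Fin n))} {r₁ : EuclideanSpace ℂ (Fin n) → ℝ}
    (hr : IsC11DefiningFunction D U r) (hr₁ : IsC11DefiningFunction D U₁ r₁)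
    (hb : Bornology.IsBounded D) (h : StronglyCLinearlyConvex D r) :
    StronglyCLinearlyConvex D r₁ := by
  obtain ⟨c, hc, h⟩ := h
  obtain ⟨m, hm, hmle⟩ := hr₁.exists_pos_le_norm_fderiv hb
  have hfr : IsCompact (frontier D) := hb.isCompact_closure.of_isClosed_subset isClosed_frontier
    frontier_subset_closure
  obtain ⟨M, hM⟩ := hfr.exists_bound_of_continuousOn
    (hr.continuousOn_fderiv.mono hr.frontier_subset)
  refine ⟨m / (|M| + 1) * c, by positivity, fun z hz ζ hζ => ?_⟩
  obtain ⟨a, ha⟩ := hr.exists_fderiv_eq_smul hr₁ hζ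
  have hL : ‖lerayPairing r₁ ζ z‖ = |a| * ‖lerayPairing r ζ z‖ := by
    rw [lerayPairing_eq_extendRCLike, lerayPairing_eq_extendRCLike, ha, map_smul,
      smul_apply, mul_smul_comm, norm_smul, Real.norm_eq_abs]
  have h1 : m / (|M| + 1) ≤ |a| := by
    rw [div_le_iff₀ (by positivity)]
    have h1 := hmle ζ hζ
    rw [ha, norm_smul, Real.norm_eq_abs] at h1
    refine h1.trans (mul_le_mul_of_nonneg_left ?_ (abs_nonneg a))
    linarith [hM ζ hζ, le_abs_self M]
  rw [hL, mul_assoc]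
  exact mul_le_mul h1 (h z hz ζ hζ) (by positivity) (abs_nonneg a)

end IsC11DefiningFunction

theorem theorem1p1 (n : ℕ) (D : Set (EuclideanSpace ℂ (Fin n)))
    (hD_open : IsOpen D) (hD_conn : IsConnected D) (hD_bdd : Bornology.IsBounded D)
    (U₀ : Set (EuclideanSpace ℂ (Fin n))) (r : EuclideanSpace ℂ (Fin n) → ℝ)
    (hr : IsC11DefiningFunction D U₀ r) :
    (StronglyCLinearlyConvex D r ↔ ExteriorQuadraticBound D U₀ r) ∧
    (StronglyCLinearlyConvex D r ↔ ExteriorDefiningBound D U₀ r) ∧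
    (StronglyCLinearlyConvex D r ↔ BoundaryQuadraticBound D r) ∧
    (∀ (U₁ : Set (EuclideanSpace ℂ (Fin n))) (r₁ : EuclideanSpace ℂ (Fin n) → ℝ),
      IsC11DefiningFunction D U₁ r₁ →
        (ExteriorQuadraticBound D U₀ r ↔ ExteriorQuadraticBound D U₁ r₁)) := by
  refine ⟨hr.stronglyCLinearlyConvex_iff_exteriorQuadraticBound hD_bdd,
    ⟨hr.exteriorDefiningBound_of_stronglyCLinearlyConvex hD_bdd, fun h =>
      hr.stronglyCLinearlyConvex_of_exteriorQuadraticBound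
        (hr.exteriorQuadraticBound_of_exteriorDefiningBound h)⟩,
    hr.stronglyCLinearlyConvex_iff_boundaryQuadraticBound hD_bdd, fun U₁ r₁ hr₁ => ?_⟩
  rw [← hr.stronglyCLinearlyConvex_iff_exteriorQuadraticBound hD_bdd,
    ← hr₁.stronglyCLinearlyConvex_iff_exteriorQuadraticBound hD_bdd]
  exact ⟨hr.stronglyCLinearlyConvex_of_stronglyCLinearlyConvex hr₁ hD_bdd,
    hr₁.stronglyCLinearlyConvex_of_stronglyCLinearlyConvex hr hD_bdd⟩
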